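/- **Theorem (Bailey Transform for $A_\ell$ and $C_\ell$).** Let $\ell\ge 1$ be an integer, let $q$ be a complex number with $0<|q|<1$, and let $a,x_1,\dots,x_\ell$ be elements of a field extension $K$ of $\mathbb C$ (for instance indeterminates, with $K=\mathbb C(a,x_1,\dots,x_\ell)$, or complex numbers, with $K=\mathbb C$). For $\alpha\in K$ and $n\in\mathbb Z$ put $$(\alpha)_n=\prod_{k=0}^{n-1}(1-\alpha q^k)\ \ (n\ge 0),\qquad (\alpha)_n=\prod_{k=1}^{-n}(1-\alpha q^{-k})^{-1}\ \ (n<0),$$ so that for $\alpha\in\mathbb C$ one has $(\alpha)_n=(\alpha)_\infty/(\alpha q^n)_\infty$ with $(\alpha)_\infty=\prod_{k\ge0}(1-\alpha q^k)$, whenever $(\alpha q^n)_\infty\neq0$; for $n<0$ the reciprocal $(\alpha)_n^{-1}$ means $\prod_{k=1}^{-n}(1-\alpha q^{-k})$. For $\boldsymbol i,\boldsymbol j\in\mathbb Z_{\ge0}^{\ell}$ write $|\boldsymbol i|=i_1+\cdots+i_\ell$, and $\boldsymbol j\le\boldsymbol i$ if $j_k\le i_k$ for $k=1,\dots,\ell$.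 Define $$M(\boldsymbol i;\boldsymbol j;A_\ell)=\prod_{r,s=1}^{\ell}\Bigl(q\tfrac{x_r}{x_s}q^{j_r-j_s}\Bigr)_{i_r-j_r}^{-1}\prod_{k=1}^{\ell}\Bigl(aq\tfrac{x_k}{x_\ell}\Bigr)_{i_k+|\boldsymbol j|}^{-1},$$ $$\begin{aligned}M^*(\boldsymbol i;\boldsymbol j;A_\ell)={}&\prod_{k=1}^{\ell}\Bigl[1-a\tfrac{x_k}{x_\ell}q^{i_k+|\boldsymbol i|}\Bigr]\prod_{k=1}^{\ell}\Bigl(aq\tfrac{x_k}{x_\ell}\Bigr)_{j_k+|\boldsymbol i|-1}\\&\times\prod_{r,s=1}^{\ell}\Bigl(q\tfrac{x_r}{x_s}q^{j_r-j_s}\Bigr)_{i_r-j_r}^{-1}(-1)^{|\boldsymbol i|-|\boldsymbol j|}q^{\binom{|\boldsymbol i|-|\boldsymbol j|}{2}},\end{aligned}$$ $$M(\boldsymbol i;\boldsymbol j;C_\ell)=\prod_{r,s=1}^{\ell}\Bigl[\Bigl(q\tfrac{x_r}{x_s}q^{j_r-j_s}\Bigr)_{i_r-j_r}^{-1}\bigl(qx_rx_sq^{j_r+j_s}\bigr)_{i_r-j_r}^{-1}\Bigr],$$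 $$\begin{aligned}M^*(\boldsymbol i;\boldsymbol j;C_\ell)={}&\prod_{r,s=1}^{\ell}\Bigl[\Bigl(q\tfrac{x_r}{x_s}q^{j_r-j_s}\Bigr)_{i_r-j_r}^{-1}\bigl(x_rx_sq^{j_r+i_s}\bigr)_{i_r-j_r}^{-1}\Bigr]\\&\times\prod_{1\le r<s\le\ell}\frac{1-x_rx_sq^{j_r+j_s}}{1-x_rx_sq^{i_r+i_s}}\;(-1)^{|\boldsymbol i|-|\boldsymbol j|}q^{\binom{|\boldsymbol i|-|\boldsymbol j|}{2}}.\end{aligned}$$ Let $G=A_\ell$ or $G=C_\ell$, and suppose that none of the denominators in the definitions of $M(\boldsymbol i;\boldsymbol j;G)$ and $M^*(\boldsymbol i;\boldsymbol j;G)$ vanishes for any $\boldsymbol j\le\boldsymbol i$. (This includes the denominators $x_k$, and, for $G=A_\ell$, the denominators $1-ax_k/x_\ell$ of $(aqx_k/x_\ell)_{-1}$.) Then $M$ and $M^*$, with rows and columns indexed by $\mathbb Z_{\ge0}^\ell$ in lexicographic order, are lower triangular, all their entries at $(\boldsymbol i;\boldsymbol j)$ vanish unless $\boldsymbol j\le\boldsymbol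 i$, and they are inverse to each other: for all $\boldsymbol i,\boldsymbol j\in\mathbb Z_{\ge0}^\ell$, $$\sum_{\boldsymbol j\le\boldsymbol y\le\boldsymbol i}M(\boldsymbol i;\boldsymbol y;G)\,M^*(\boldsymbol y;\boldsymbol j;G)=\prod_{k=1}^{\ell}\delta(i_k,j_k)=\sum_{\boldsymbol j\le\boldsymbol y\le\boldsymbol i}M^*(\boldsymbol i;\boldsymbol y;G)\,M(\boldsymbol y;\boldsymbol j;G),$$ where $\delta(r,s)=1$ if $r=s$ and $0$ otherwise. -/

import Mathlib

noncomputable section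

namespace BaileyTransform

/-- The infinite product `(α; q)_∞ = ∏_{k ≥ 0} (1 - α q ^ k)` for complex `q`, `α`
(convergent for `‖q‖ < 1`). -/
def qPochInf (q α : ℂ) : ℂ := ∏' k : ℕ, (1 - α * q ^ k)

/-- The `q`-shifted factorial `(α; q)_n` for an integer `n`:
`∏_{0 ≤ k < n} (1 - α q ^ k)` for `n ≥ 0` and `1 / ∏_{1 ≤ k ≤ -n} (1 - α q ^ (-k))` for `n < 0`.
For complex numbers this is `(α; q)_∞ / (α q ^ n; q)_∞`, see `qPoch_eq_div`. -/
def qPoch {K : Type*} [Field K] (q α : K) (n : ℤ) : K :=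
  (∏ k ∈ Finset.range n.toNat, (1 - α * q ^ k)) /
    ∏ k ∈ Finset.range (-n).toNat, (1 - α * q ^ (-((k : ℤ) + 1)))

theorem qPochInf_eq_mul {q : ℂ} (hq : ‖q‖ < 1) (α : ℂ) (n : ℕ) :
    qPochInf q α = (∏ k ∈ Finset.range n, (1 - α * q ^ k)) * qPochInf q (α * q ^ n) := by
  induction n with
  | zero => simp
  | succ n ih =>
    rw [ih, Finset.prod_range_succ, mul_assoc]
    congr 1
    have hs : Multipliable fun k : ℕ => (1 - α * q ^ (n + 1) * q ^ k) := by
      simp only [sub_eq_add_neg]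
      apply multipliable_one_add_of_summable
      simp only [norm_neg, norm_mul, norm_pow]
      exact (summable_geometric_of_lt_one (norm_nonneg q) hq).mul_left _
    have h := tprod_eq_zero_mul' (f := fun k : ℕ => (1 - α * q ^ n * q ^ k)) (by
      refine hs.congr fun k => ?_
      ring)
    unfold qPochInf
    rw [h]
    simp only [pow_zero, mul_one]
    congr 1
    refine tprod_congr fun k => ?_
    ring

/-- The `q`-shifted factorial is the quotient of infinite products `(α)_∞ / (α q ^ n)_∞`. -/
theorem qPoch_eq_div {q : ℂ} (hq0 : q ≠ 0) (hq : ‖q‖ < 1) (α : ℂ) (n : ℤ)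
    (h : qPochInf q (α * q ^ n) ≠ 0) :
    qPoch q α n = qPochInf q α / qPochInf q (α * q ^ n) := by
  obtain ⟨m, rfl | rfl⟩ := n.eq_nat_or_neg
  · rw [zpow_natCast] at h ⊢
    rw [qPochInf_eq_mul hq α m, mul_div_assoc, div_self h]
    simp [qPoch]
  · have h2 := qPochInf_eq_mul hq (α * q ^ (-(m : ℤ))) m
    have h3 : α * q ^ (-(m : ℤ)) * q ^ m = α := by
      rw [mul_assoc, zpow_neg, zpow_natCast, inv_mul_cancel₀ (pow_ne_zero _ hq0), mul_one]
    rw [h3] at h2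
    have h4 : ∏ k ∈ Finset.range m, (1 - α * q ^ (-(m : ℤ)) * q ^ k) =
        ∏ k ∈ Finset.range m, (1 - α * q ^ (-((k : ℤ) + 1))) := by
      rw [← Finset.prod_range_reflect]
      refine Finset.prod_congr rfl fun k hk => ?_
      rw [Finset.mem_range] at hk
      rw [mul_assoc, ← zpow_natCast q (m - 1 - k), ← zpow_add₀ hq0]
      congr 3
      omega
    rw [h4] at h2
    have h5 : qPochInf q α ≠ 0 := fun h0 => h (by rw [h2, h0, mul_zero])
    rw [h2, div_mul_cancel_right₀ h5]
    simp [qPoch]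

section Matrices

variable {K : Type*} [Field K] {n : ℕ}

/-- `|i| = i_1 + ⋯ + i_ℓ`. -/
def total {l : ℕ} (i : Fin l → ℕ) : ℤ := ∑ k, (i k : ℤ)

/-- `(-1) ^ m * q ^ (m choose 2)` with `m = |i| - |j|`. -/
def signPow {l : ℕ} (q : K) (i j : Fin l → ℕ) : K :=
  (-1) ^ (total i - total j) *
    q ^ ((total i - total j) * (total i - total j - 1) / 2)

/-- `(q (x_r / x_s) q ^ (j_r - j_s); q)_{i_r - j_r}`. -/
def facA {l : ℕ} (q : K) (x : Fin l → K) (i j : Fin l → ℕ) (r s : Fin l) : K :=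
  qPoch q (q * (x r / x s) * q ^ ((j r : ℤ) - j s)) ((i r : ℤ) - j r)

/-- The matrix `M(i; j; A_ℓ)`, where `ℓ = n + 1`, so that `x_ℓ` is `x (Fin.last n)`. -/
def MA (q a : K) (x : Fin (n + 1) → K) (i j : Fin (n + 1) → ℕ) : K :=
  (∏ r, ∏ s, (facA q x i j r s)⁻¹) *
    ∏ k, (qPoch q (a * q * (x k / x (Fin.last n))) (i k + total j))⁻¹

/-- The matrix `M*(i; j; A_ℓ)`, where `ℓ = n + 1`. -/
def MAstar (q a : K) (x : Fin (n + 1) → K) (i j : Fin (n + 1) → ℕ) : K :=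
  (∏ k, (1 - a * (x k / x (Fin.last n)) * q ^ (i k + total i))) *
    (∏ k, qPoch q (a * q * (x k / x (Fin.last n))) (j k + total i - 1)) *
    (∏ r, ∏ s, (facA q x i j r s)⁻¹) * signPow q i j

/-- No denominator in the definitions of `M(i; j; A_ℓ)` and `M*(i; j; A_ℓ)`, `j ≤ i`, vanishes.
The last clause is about `(a q x_k / x_ℓ; q)_{-1} = 1 / (1 - a x_k / x_ℓ)`, which occurs in
`M*(0; 0; A_ℓ)`. -/
def NondegenerateA (q a : K) (x : Fin (n + 1) → K) : Prop :=
  (∀ k, x k ≠ 0) ∧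
  (∀ i j : Fin (n + 1) → ℕ, j ≤ i →
    (∀ r s, facA q x i j r s ≠ 0) ∧
    ∀ k, qPoch q (a * q * (x k / x (Fin.last n))) (i k + total j) ≠ 0) ∧
  ∀ k, 1 - a * (x k / x (Fin.last n)) ≠ 0

/-- `(q x_r x_s q ^ (j_r + j_s); q)_{i_r - j_r}`. -/
def facC {l : ℕ} (q : K) (x : Fin l → K) (i j : Fin l → ℕ) (r s : Fin l) : K :=
  qPoch q (q * x r * x s * q ^ (j r + j s)) ((i r : ℤ) - j r)

/-- `(x_r x_s q ^ (j_r + i_s); q)_{i_r - j_r}`. -/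
def facCstar {l : ℕ} (q : K) (x : Fin l → K) (i j : Fin l → ℕ) (r s : Fin l) : K :=
  qPoch q (x r * x s * q ^ (j r + i s)) ((i r : ℤ) - j r)

/-- The matrix `M(i; j; C_ℓ)`. -/
def MC {l : ℕ} (q : K) (x : Fin l → K) (i j : Fin l → ℕ) : K :=
  ∏ r, ∏ s, ((facA q x i j r s)⁻¹ * (facC q x i j r s)⁻¹)

/-- The matrix `M*(i; j; C_ℓ)`. -/
def MCstar {l : ℕ} (q : K) (x : Fin l → K) (i j : Fin l → ℕ) : K :=
  (∏ r, ∏ s, ((facA q x i j r s)⁻¹ * (facCstar q x i j r s)⁻¹)) *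
    (∏ r, ∏ s ∈ Finset.Ioi r,
      ((1 - x r * x s * q ^ (j r + j s)) / (1 - x r * x s * q ^ (i r + i s)))) *
    signPow q i j

/-- No denominator in the definitions of `M(i; j; C_ℓ)` and `M*(i; j; C_ℓ)`, `j ≤ i`, vanishes. -/
def NondegenerateC {l : ℕ} (q : K) (x : Fin l → K) : Prop :=
  (∀ k, x k ≠ 0) ∧
  (∀ i j : Fin l → ℕ, j ≤ i →
    ∀ r s, facA q x i j r s ≠ 0 ∧ facC q x i j r s ≠ 0 ∧ facCstar q x i j r s ≠ 0) ∧
  ∀ (i : Fin l → ℕ) (r s : Fin l), r < s → 1 - x r * x s * q ^ (i r + i s) ≠ 0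

/-- A matrix indexed by `ℓ`-tuples is lower triangular with respect to the lexicographic order:
entries above the diagonal vanish. -/
def IsLowerTriangular {l : ℕ} (M : (Fin l → ℕ) → (Fin l → ℕ) → K) : Prop :=
  ∀ i j, toLex i < toLex j → M i j = 0

/-- `M` and `N` are inverse to each other, as infinite lower triangular matrices. All entries
`(i, j)` for which `j ≤ i` fails componentwise vanish, so the matrix product `∑_y M(i; y) N(y; j)`
is the finite sum over the tuples `y` with `j_k ≤ y_k ≤ i_k` for all `k`. -/
def AreInverseLowerTriangular {l : ℕ} (M N : (Fin l → ℕ) → (Fin l → ℕ) → K) : Prop :=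
  IsLowerTriangular M ∧ IsLowerTriangular N ∧
  (∀ i j, ¬ j ≤ i → M i j = 0 ∧ N i j = 0) ∧
  (∀ i j, ∑ y ∈ Finset.Icc j i, M i y * N y j = ∏ k, if i k = j k then 1 else 0) ∧
  (∀ i j, ∑ y ∈ Finset.Icc j i, N i y * M y j = ∏ k, if i k = j k then 1 else 0)

end Matrices

end BaileyTransform

end

namespace BaileyTransform

/-! ### Sums of antisymmetric products over a box -/

section Antisymmetric

variable {K α : Type*} [Field K] {l : ℕ}

open Finset Function

/-! Triangularity cuts the problem down to finite square matrices, where a one-sided inverse is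
two-sided; so only `M* M = 1` has to be shown. The diagonal is a direct cancellation. For the entry
at `(j + ν, j)` with `ν ≠ 0`, replacing `x_r` by `X_r = x_r q ^ j_r` turns the sum into one over `0
≤ a ≤ ν`.

Consider the `|ν| + ℓ` nodes `X_r q ^ m`, `0 ≤ m ≤ ν_r`. Up to a constant independent of `a`, the
factors in `x_r / x_s` and the sign are the product of the Lagrange weights at the chosen nodes `u_r
= X_r q ^ a_r` times the Vandermonde product of the `u_r` (`exists_prod_facA_eq`). The other factors
give `∏ P(u_r)` with `deg P ≤ |ν| - 1` for `A_ℓ`. For `C_ℓ` they give rational factors in each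
`u_r`, together with `∏ (1 - u_r u_s)`.

The summand is thus a product of one-node weights times an antisymmetric function, and `u_r` runs
over the nodes of row `r`. Let one coordinate `r₀` run over all nodes instead: the extra terms,
where coordinates `r₀` and `r` share row `r`, cancel under exchange of the two
(`sum_piFinset_prod_mul_prod_antisymm_eq_zero`). With the other coordinates fixed, what remains is a
Lagrange-weighted sum of values of a polynomial of degree at most `|ν| + ℓ - 2` over `|ν| + ℓ`
nodes, which vanishes (`sum_weight_mul_eval`). -/

theorem exists_prod_update_eq {φ : α → α → K} (hφ : ∀ s t, φ s t = -φ t s)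
    (w : α → K) (p : Fin l → α) (r₀ : Fin l) :
    ∃ c : K, ∀ t, (∏ r, w (update p r₀ t r)) *
        ∏ r, ∏ s ∈ Ioi r, φ (update p r₀ t r) (update p r₀ t s) =
      c * (w t * ∏ s ∈ {r₀}ᶜ, φ t (p s)) := by
  -- The signs come from turning `φ (p r) t` into `-φ t (p r)` for the indices `r < r₀`.
  refine ⟨(∏ r ∈ {r₀}ᶜ, w (p r)) * (∏ r ∈ {r₀}ᶜ, if r < r₀ then -1 else 1) *
    ∏ r ∈ {r₀}ᶜ, ∏ s ∈ (Ioi r).erase r₀, φ (p r) (p s), fun t => ?_⟩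
  have hne : ∀ r ∈ ({r₀}ᶜ : Finset (Fin l)), update p r₀ t r = p r := fun r hr =>
    update_of_ne (by simpa using hr) _ _
  have h1 : ∏ r, w (update p r₀ t r) = w t * ∏ r ∈ {r₀}ᶜ, w (p r) := by
    rw [Fintype.prod_eq_mul_prod_compl r₀, update_self]
    congr 1
    exact prod_congr rfl fun r hr => by rw [hne r hr]
  have h2 : ∀ r ∈ ({r₀}ᶜ : Finset (Fin l)),
      ∏ s ∈ Ioi r, φ (update p r₀ t r) (update p r₀ t s) =
        (if r < r₀ then -1 else 1) * (if r < r₀ then φ t (p r) else 1) *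
          ∏ s ∈ (Ioi r).erase r₀, φ (p r) (p s) := by
    intro r hr
    rw [hne r hr]
    have h3 : ∏ s ∈ (Ioi r).erase r₀, φ (p r) (update p r₀ t s) =
        ∏ s ∈ (Ioi r).erase r₀, φ (p r) (p s) :=
      prod_congr rfl fun s hs => by rw [update_of_ne (ne_of_mem_erase hs)]
    split_ifs with h
    · rw [← mul_prod_erase _ _ (mem_Ioi.2 h), h3, update_self, hφ (p r) t]
      ring
    · rw [← h3, erase_eq_of_notMem (by simpa using h)]
      ring
  have h4 : ∏ s ∈ Ioi r₀, φ (update p r₀ t r₀) (update p r₀ t s) =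
      ∏ r ∈ {r₀}ᶜ, if r < r₀ then 1 else φ t (p r) := by
    rw [update_self]
    symm
    rw [← prod_filter_mul_prod_filter_not {r₀}ᶜ (fun r => r < r₀),
      prod_eq_one (fun r hr => by rw [if_pos (mem_filter.1 hr).2]), one_mul]
    symm
    refine prod_congr ?_ fun s hs => ?_
    · ext s
      simp only [mem_Ioi, mem_filter, mem_compl, mem_singleton, not_lt]
      exact ⟨fun h => ⟨h.ne', h.le⟩, fun h => lt_of_le_of_ne h.2 (Ne.symm h.1)⟩
    · rw [if_neg (mem_filter.1 hs).2, update_of_ne]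
      simpa using (mem_filter.1 hs).1
  have h5 : ∏ s ∈ {r₀}ᶜ, φ t (p s) = (∏ r ∈ {r₀}ᶜ, if r < r₀ then φ t (p r) else 1) *
      ∏ r ∈ {r₀}ᶜ, if r < r₀ then 1 else φ t (p r) := by
    rw [← prod_mul_distrib]
    exact prod_congr rfl fun r _ => by split_ifs <;> simp
  rw [h1, Fintype.prod_eq_mul_prod_compl r₀, h4, prod_congr rfl h2, prod_mul_distrib,
    prod_mul_distrib, h5]
  ring

/-- Enlarging the range of coordinate `r₀` from `A r₀` to every `A r` in turn adds only zero sums,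
by antisymmetry; the enlarged sum is a combination of the one-variable sums in `h`. -/
theorem sum_piFinset_prod_mul_prod_antisymm_eq_zero [CharZero K] {φ : α → α → K}
    (hφ : ∀ s t, φ s t = -φ t s) (w : α → K) (A : Fin l → Finset α) (r₀ : Fin l)
    (h : ∀ p : Fin l → α, (∀ s, s ≠ r₀ → p s ∈ A s) →
      ∑ r, ∑ t ∈ A r, w t * ∏ s ∈ {r₀}ᶜ, φ t (p s) = 0) :
    ∑ p ∈ Fintype.piFinset A, (∏ r, w (p r)) * ∏ r, ∏ s ∈ Ioi r, φ (p r) (p s) = 0 := by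
  classical
  set F : (Fin l → α) → K := fun p => (∏ r, w (p r)) * ∏ r, ∏ s ∈ Ioi r, φ (p r) (p s) with hF
  rcases (A r₀).eq_empty_or_nonempty with he | ⟨c, -⟩
  · refine sum_eq_zero fun p hp => ?_
    have := Fintype.mem_piFinset.1 hp r₀
    simp [he] at this
  -- The remaining coordinates are parametrized by tuples whose slot `r₀` is pinned to the dummy
  -- value `c`, so the outer sum does not depend on `B`.
  have split : ∀ B : Finset α, ∑ p ∈ Fintype.piFinset (update A r₀ B), F p =
      ∑ p ∈ Fintype.piFinset (update A r₀ {c}), ∑ t ∈ B, F (update p r₀ t) := by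
    intro B
    rw [← sum_product']
    refine sum_nbij' (fun p => (update p r₀ c, p r₀)) (fun z => update z.1 r₀ z.2)
      ?_ ?_ ?_ ?_ ?_
    · intro p hp
      rw [Fintype.mem_piFinset] at hp
      rw [mem_product, Fintype.mem_piFinset]
      refine ⟨fun s => ?_, by simpa using hp r₀⟩
      rcases eq_or_ne s r₀ with rfl | hs
      · simp
      · simpa [hs] using hp s
    · rintro ⟨p, t⟩ hp
      rw [mem_product, Fintype.mem_piFinset] at hp
      rw [Fintype.mem_piFinset]
      intro s
      rcases eq_or_ne s r₀ with rfl | hs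
      · simpa using hp.2
      · simpa [hs] using hp.1 s
    · intro p _
      simp
    · rintro ⟨p, t⟩ hp
      rw [mem_product, Fintype.mem_piFinset] at hp
      have := hp.1 r₀
      simp only [update_self, mem_singleton] at this
      simp [← this]
    · intro p _
      simp
  have anti : ∀ r, r ≠ r₀ → ∑ p ∈ Fintype.piFinset (update A r₀ (A r)), F p = 0 := by
    intro r hr
    -- Slots `r₀` and `r` now have the same range, so swapping them preserves the box and negates
    -- `F`; characteristic zero gives the vanishing.
    rw [← self_eq_neg, ← sum_neg_distrib]
    have hA : ∀ s, update A r₀ (A r) (Equiv.swap r₀ r s) = update A r₀ (A r) s := by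
      intro s
      rcases eq_or_ne s r₀ with rfl | hs
      · simp [hr]
      rcases eq_or_ne s r with rfl | hs'
      · simp [hs]
      · rw [Equiv.swap_apply_of_ne_of_ne hs hs']
    have hmem : ∀ p ∈ Fintype.piFinset (update A r₀ (A r)),
        p ∘ Equiv.swap r₀ r ∈ Fintype.piFinset (update A r₀ (A r)) := by
      intro p hp
      rw [Fintype.mem_piFinset] at hp ⊢
      intro s
      rw [← hA]
      exact hp _
    refine sum_nbij' (fun p => p ∘ Equiv.swap r₀ r) (fun p => p ∘ Equiv.swap r₀ r)
      hmem hmem ?_ ?_ ?_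
    · intro p _
      ext s
      simp
    · intro p _
      ext s
      simp
    · intro p _
      simp only [hF, comp_apply]
      rw [Equiv.prod_comp (Equiv.swap r₀ r) fun s => w (p s),
        (Equiv.swap r₀ r).prod_Ioi_comp_eq_sign_mul_prod (f := fun s t => φ (p s) (p t))
          (fun s t => hφ _ _), Equiv.Perm.sign_swap hr.symm]
      simp
  have total : ∑ r, ∑ p ∈ Fintype.piFinset (update A r₀ (A r)), F p = 0 := by
    simp_rw [split]
    rw [sum_comm]
    refine sum_eq_zero fun p hp => ?_
    obtain ⟨d, hd⟩ := exists_prod_update_eq hφ w p r₀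
    simp only [hF, hd, ← mul_sum]
    rw [h p, mul_zero]
    intro s hs
    rw [Fintype.mem_piFinset] at hp
    simpa [hs] using hp s
  rw [Fintype.sum_eq_single r₀ anti, update_eq_self] at total
  exact total

end Antisymmetric

/-! ### From a one-sided to a two-sided inverse -/

section Inverse

variable {K : Type*} [Field K] {l : ℕ}

theorem areInverseLowerTriangular_of_mul_eq {M N : (Fin l → ℕ) → (Fin l → ℕ) → K}
    (hM : ∀ i j, ¬ j ≤ i → M i j = 0) (hN : ∀ i j, ¬ j ≤ i → N i j = 0)
    (hdiag : ∀ i, N i i * M i i = 1)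
    (hoff : ∀ i j, j ≤ i → j ≠ i → ∑ y ∈ Finset.Icc j i, N i y * M y j = 0) :
    AreInverseLowerTriangular M N := by
  have lower : ∀ L : (Fin l → ℕ) → (Fin l → ℕ) → K, (∀ i j, ¬ j ≤ i → L i j = 0) →
      IsLowerTriangular L := fun L hL i j hij =>
    hL i j fun h => absurd (Pi.toLex_monotone h) (not_le_of_gt hij)
  have delta : ∀ i j : Fin l → ℕ, (∏ k, if i k = j k then (1 : K) else 0) =
      if i = j then 1 else 0 := by
    intro i j
    split_ifs with h
    · exact Finset.prod_eq_one fun k _ => if_pos (congrFun h k)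
    · obtain ⟨k, hk⟩ := Function.ne_iff.1 h
      exact Finset.prod_eq_zero (Finset.mem_univ k) (if_neg hk)
  have hNM : ∀ i j, ∑ y ∈ Finset.Icc j i, N i y * M y j = if i = j then 1 else 0 := by
    intro i j
    split_ifs with h
    · subst h
      simpa using hdiag i
    · by_cases hij : j ≤ i
      · exact hoff i j hij (Ne.symm h)
      · rw [Finset.Icc_eq_empty hij, Finset.sum_empty]
  have sum_subtype : ∀ (A B : (Fin l → ℕ) → (Fin l → ℕ) → K),
      (∀ i j, ¬ j ≤ i → A i j = 0) → (∀ i j, ¬ j ≤ i → B i j = 0) →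
      ∀ m i j : Fin l → ℕ, i ≤ m → ∑ y : Finset.Iic m, A i y * B y j =
        ∑ y ∈ Finset.Icc j i, A i y * B y j := by
    intro A B hA hB m i j hi
    rw [Finset.sum_coe_sort (Finset.Iic m) fun y => A i y * B y j]
    symm
    refine Finset.sum_subset (fun y hy => ?_) fun y _ hy => ?_
    · exact Finset.mem_Iic.2 ((Finset.mem_Icc.1 hy).2.trans hi)
    · rw [Finset.mem_Icc, not_and_or] at hy
      rcases hy with hy | hy
      · rw [hB _ _ hy, mul_zero]
      · rw [hA _ _ hy, zero_mul]
  refine ⟨lower M hM, lower N hN, fun i j h => ⟨hM i j h, hN i j h⟩, fun i j => ?_, fun i j => ?_⟩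
  · rw [delta]
    by_cases hij : j ≤ i
    -- Entries off `j ≤ i` vanish, so truncation to the finite down-set `Iic i` respects the matrix
    -- product, and finite square matrices satisfy `N' * M' = 1 → M' * N' = 1`.
    · let M' : Matrix (Finset.Iic i) (Finset.Iic i) K := .of fun a b => M a b
      let N' : Matrix (Finset.Iic i) (Finset.Iic i) K := .of fun a b => N a b
      have h1 : N' * M' = 1 := by
        ext a b
        rw [Matrix.mul_apply, Matrix.one_apply]
        simp only [N', M', Matrix.of_apply]
        rw [sum_subtype N M hN hM i a b (Finset.mem_Iic.1 a.2), hNM]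
        simp only [← Subtype.ext_iff]
      have h2 : M' * N' = 1 := mul_eq_one_comm.1 h1
      have h3 := congrFun (congrFun h2 ⟨i, by simp⟩) ⟨j, by simpa using hij⟩
      rw [Matrix.mul_apply, Matrix.one_apply] at h3
      simp only [N', M', Matrix.of_apply] at h3
      rw [sum_subtype M N hM hN i i j le_rfl] at h3
      simpa only [Subtype.mk.injEq] using h3
    · rw [Finset.Icc_eq_empty hij, Finset.sum_empty, if_neg]
      rintro rfl
      exact hij le_rfl
  · rw [delta, hNM]

end Inverse

/-! ### Lagrange weights and the factors in `x_r / x_s` -/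

section Weights

variable {K : Type*} [Field K] {l : ℕ}

open Finset

theorem two_mul_choose_two_add (d : ℕ) : 2 * d.choose 2 + d = d * d := by
  induction d with
  | zero => rfl
  | succ d ih =>
    rw [Nat.choose_succ_succ' d 1, Nat.choose_one_right]
    linarith

theorem choose_two_add (a d : ℕ) : (a + d).choose 2 = a.choose 2 + d.choose 2 + a * d := by
  have h1 := two_mul_choose_two_add a
  have h2 := two_mul_choose_two_add d
  have h3 := two_mul_choose_two_add (a + d)
  linarith

theorem prod_prod_eq_prod_diag_mul {R : Type*} [CommMonoid R] (f : Fin l → Fin l → R) :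
    ∏ r, ∏ s, f r s = (∏ r, f r r) * ∏ r, ∏ s ∈ Ioi r, f s r * f r s := by
  rw [prod_prod_Ioi_mul_eq_prod_prod_off_diag, ← prod_mul_distrib, prod_comm]
  exact prod_congr rfl fun r _ => Fintype.prod_eq_mul_prod_compl r fun s => f s r

theorem sum_choose_two_add_sum_mul (a : Fin l → ℕ) :
    ∑ r, (a r).choose 2 + ∑ r, ∑ s ∈ Ioi r, a s * a r = (∑ r, a r).choose 2 := by
  have h1 := two_mul_choose_two_add (∑ r, a r)
  have h2 : 2 * ∑ r, (a r).choose 2 + ∑ r, a r = ∑ r, a r * a r := by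
    rw [mul_sum, ← sum_add_distrib]
    exact sum_congr rfl fun r _ => two_mul_choose_two_add _
  have h3 : (∑ r, a r) * (∑ r, a r) = ∑ r, a r * a r + 2 * ∑ r, ∑ s ∈ Ioi r, a s * a r := by
    rw [sum_mul_sum]
    -- The splitting into diagonal and pairs is reused additively through `Multiplicative ℕ`.
    have := prod_prod_eq_prod_diag_mul (R := Multiplicative ℕ) (l := l)
      fun r s => Multiplicative.ofAdd (a r * a s)
    simp only [← ofAdd_add, ← ofAdd_sum] at this
    rw [Multiplicative.ofAdd.injective this, mul_sum]
    congr 1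
    refine sum_congr rfl fun r _ => ?_
    rw [mul_sum]
    exact sum_congr rfl fun s _ => by ring
  linarith

/-- The contribution of a pair `r < s` to `prod_vandermonde_mul`; `prod_range_diag` is that of `r =
s`. -/
theorem prod_range_pair (q X Y : K) (a b : ℕ) :
    (X - Y) * (∏ m ∈ range a, (Y - X * q ^ (m + 1))) * (∏ m ∈ range b, (X - Y * q ^ (m + 1))) *
        q ^ (a * b) =
      (X * q ^ a - Y * q ^ b) * (∏ m ∈ range a, (Y * q ^ b - X * q ^ m)) *
        ∏ m ∈ range b, (X * q ^ a - Y * q ^ m) := by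
  induction a with
  | zero =>
    have h := prod_range_succ' (fun m => X - Y * q ^ m) b
    rw [prod_range_succ] at h
    simp only [range_zero, prod_empty, zero_mul, pow_zero, mul_one] at h ⊢
    linear_combination -h
  | succ a ih =>
    -- One product of `b + 1` factors, with the last or the first factor split off.
    have h : (∏ m ∈ range b, (X * q ^ (a + 1) - Y * q ^ m)) * (X * q ^ (a + 1) - Y * q ^ b) =
        q ^ b * (∏ m ∈ range b, (X * q ^ a - Y * q ^ m)) * (X * q ^ (a + 1) - Y) := by
      rw [← prod_range_succ (fun m => X * q ^ (a + 1) - Y * q ^ m) b, prod_range_succ', pow_zero,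
        mul_one]
      congr 1
      rw [← card_range b, ← prod_const, card_range, ← prod_mul_distrib]
      exact prod_congr rfl fun m _ => by ring
    rw [prod_range_succ, prod_range_succ, add_mul, one_mul, pow_add q (a * b) b]
    linear_combination (Y - X * q ^ (a + 1)) * q ^ b * ih -
      (Y * q ^ b - X * q ^ a) * (∏ m ∈ range a, (Y * q ^ b - X * q ^ m)) * h

theorem prod_range_diag (q X : K) (a : ℕ) :
    (∏ m ∈ range a, (X - X * q ^ (m + 1))) * ((-1) ^ a * q ^ a.choose 2) =
      ∏ m ∈ range a, (X * q ^ a - X * q ^ m) := by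
  induction a with
  | zero => simp
  | succ a ih =>
    have h : ∏ m ∈ range a, (X * q ^ (a + 1) - X * q ^ (m + 1)) =
        q ^ a * ∏ m ∈ range a, (X * q ^ a - X * q ^ m) := by
      have h' := pow_card_mul_prod (s := range a) (b := q) (f := fun m => X * q ^ a - X * q ^ m)
      rw [card_range] at h'
      rw [h']
      exact prod_congr rfl fun m _ => by ring
    rw [prod_range_succ, prod_range_succ', h, ← ih, Nat.choose_succ_succ' a 1,
      Nat.choose_one_right]
    ring

/-- Converts the denominators of `facA q X a 0` into differences between the chosen nodes and the
nodes below them, as they occur in the Lagrange weights. -/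
theorem prod_vandermonde_mul (q : K) (X : Fin l → K) (a : Fin l → ℕ) :
    (∏ r, ∏ s ∈ Ioi r, (X r - X s)) *
        (∏ r, ∏ s, ∏ m ∈ range (a r), (X s - X r * q ^ (m + 1))) *
        ((-1) ^ (∑ r, a r) * q ^ (∑ r, a r).choose 2) =
      (∏ r, ∏ s ∈ Ioi r, (X r * q ^ a r - X s * q ^ a s)) *
        ∏ r, ∏ s, ∏ m ∈ range (a r), (X s * q ^ a s - X r * q ^ m) := by
  rw [prod_prod_eq_prod_diag_mul fun r s => ∏ m ∈ range (a r), (X s - X r * q ^ (m + 1)),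
    prod_prod_eq_prod_diag_mul fun r s => ∏ m ∈ range (a r), (X s * q ^ a s - X r * q ^ m),
    ← sum_choose_two_add_sum_mul, pow_add, ← prod_pow_eq_pow_sum, ← prod_pow_eq_pow_sum,
    ← prod_pow_eq_pow_sum]
  simp_rw [← prod_pow_eq_pow_sum, ← prod_range_diag]
  have h : ∀ r s, (X r * q ^ a r - X s * q ^ a s) *
      ((∏ m ∈ range (a s), (X r * q ^ a r - X s * q ^ m)) *
        ∏ m ∈ range (a r), (X s * q ^ a s - X r * q ^ m)) =
      (X r - X s) * ((∏ m ∈ range (a s), (X r - X s * q ^ (m + 1))) *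
        ∏ m ∈ range (a r), (X s - X r * q ^ (m + 1))) * q ^ (a s * a r) := by
    intro r s
    rw [mul_comm (a s)]
    linear_combination -prod_range_pair q (X r) (X s) (a r) (a s)
  have h' := prod_congr rfl fun r (_ : r ∈ univ) => prod_congr rfl fun s (_ : s ∈ Ioi r) => h r s
  simp only [prod_mul_distrib] at h' ⊢
  linear_combination (-(∏ r, ∏ m ∈ range (a r), (X r - X r * q ^ (m + 1))) *
    (∏ r, (-1) ^ a r) * ∏ r, q ^ (a r).choose 2) * h'

/-- The point `X_r q ^ m`. -/
def node (q : K) (X : Fin l → K) (p : (_ : Fin l) × ℕ) : K := X p.1 * q ^ p.2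

/-- The index set of the points `X_r q ^ m`, `0 ≤ m ≤ n_r`. -/
def nodes (n : Fin l → ℕ) : Finset ((_ : Fin l) × ℕ) :=
  univ.sigma fun r => range (n r + 1)

/-- The weight of a point in Lagrange interpolation at the points `X_r q ^ m`, `0 ≤ m ≤ n_r`. -/
def weight (q : K) (X : Fin l → K) (n : Fin l → ℕ) (p : (_ : Fin l) × ℕ) : K :=
  (∏ p' ∈ (nodes n).erase p, (node q X p - node q X p'))⁻¹

theorem card_nodes (n : Fin l → ℕ) : (nodes n).card = ∑ r, n r + l := by
  simp [nodes, sum_add_distrib]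

/-- The sum is the coefficient of degree `|n| + l - 1` in the interpolant of `P` at the `|n| + l`
nodes; this interpolant is `P`, whose degree is smaller. -/
theorem sum_weight_mul_eval (q : K) (X : Fin l → K) (n : Fin l → ℕ)
    (hinj : Function.Injective (node q X)) (P : Polynomial K)
    (hP : P.natDegree + 1 < ∑ r, n r + l) :
    ∑ r, ∑ m ∈ range (n r + 1), weight q X n ⟨r, m⟩ * P.eval (node q X ⟨r, m⟩) = 0 := by
  rw [← sum_sigma univ (fun r => range (n r + 1))
    fun p => weight q X n p * P.eval (node q X p)]
  have h := Lagrange.coeff_eq_sum (s := nodes n) (v := node q X) hinj.injOn (P := P)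
    (lt_of_le_of_lt Polynomial.degree_le_natDegree (by
      rw [card_nodes]; exact_mod_cast (Nat.lt_succ_self _).trans hP))
  rw [Polynomial.coeff_eq_zero_of_natDegree_lt (by rw [card_nodes]; omega)] at h
  rw [h]
  refine sum_congr rfl fun p _ => ?_
  rw [weight, div_eq_mul_inv, mul_comm]

theorem prod_nodes_erase {a n : Fin l → ℕ} (ha : a ≤ n) (s : Fin l)
    (g : (_ : Fin l) × ℕ → K) :
    ∏ p ∈ (nodes n).erase ⟨s, a s⟩, g p =
      (∏ r, ∏ m ∈ range (a r), g ⟨r, m⟩) *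
        (∏ r, ∏ m ∈ range (n r - a r), g ⟨r, a r + 1 + m⟩) * ∏ r ∈ {s}ᶜ, g ⟨r, a r⟩ := by
  classical
  -- Giving the omitted node the value `1` lets all rows be split uniformly.
  set g' := Function.update g ⟨s, a s⟩ 1 with hg'
  have hne : ∀ r m, m ≠ a r → g' ⟨r, m⟩ = g ⟨r, m⟩ := by
    intro r m h
    refine Function.update_of_ne (fun h' => h ?_) _ _
    cases h'
    rfl
  have h1 : ∏ p ∈ (nodes n).erase ⟨s, a s⟩, g p = ∏ p ∈ nodes n, g' p := by
    rw [← mul_prod_erase (nodes n) g' (a := ⟨s, a s⟩) (by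
      simpa [nodes] using Nat.lt_succ_of_le (ha s)), hg', Function.update_self, one_mul]
    exact prod_congr rfl fun p hp => (Function.update_of_ne (ne_of_mem_erase hp) _ _).symm
  have h2 : ∏ r ∈ {s}ᶜ, g ⟨r, a r⟩ = ∏ r, g' ⟨r, a r⟩ := by
    rw [Fintype.prod_eq_mul_prod_compl s, hg', Function.update_self, one_mul]
    refine prod_congr rfl fun r hr => (Function.update_of_ne (fun h' => ?_) _ _).symm
    rw [mem_compl, mem_singleton] at hr
    exact hr (congrArg Sigma.fst h')
  rw [h1, h2, nodes, prod_sigma, ← prod_mul_distrib, ← prod_mul_distrib]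
  refine prod_congr rfl fun r _ => ?_
  have h3 : n r + 1 = a r + (n r - a r + 1) := by
    have : a r ≤ n r := ha r
    omega
  rw [h3, prod_range_add, prod_range_succ', ← mul_assoc, add_zero]
  congr 2
  · exact prod_congr rfl fun m hm => hne r m (mem_range.1 hm).ne
  · refine prod_congr rfl fun m _ => ?_
    rw [hne r _ (by omega)]
    congr 2
    omega

/-- Clearing `X_s q ^ a_s` from each factor leaves the differences with the nodes of row `r` above
level `a r`. -/
theorem facA_mul_pow {q : K} (hq : q ≠ 0) {X : Fin l → K} (hX : ∀ r, X r ≠ 0)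
    {a n : Fin l → ℕ} (ha : a ≤ n) (r s : Fin l) :
    facA q X n a r s * (X s * q ^ a s) ^ (n r - a r) =
      ∏ m ∈ range (n r - a r), (X s * q ^ a s - X r * q ^ (a r + 1 + m)) := by
  have h1 : ((n r : ℤ) - a r) = ((n r - a r : ℕ) : ℤ) := by
    rw [Nat.cast_sub (ha r)]
  rw [facA, h1, qPoch, Int.toNat_natCast, Int.toNat_neg_natCast, range_zero, prod_empty, div_one]
  rw [← card_range (n r - a r), ← prod_const, card_range, ← prod_mul_distrib]
  refine prod_congr rfl fun m _ => ?_
  have := hX s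
  rw [zpow_sub₀ hq, zpow_natCast, zpow_natCast]
  field_simp
  ring

theorem signPow_eq (q : K) {a n : Fin l → ℕ} (ha : a ≤ n) :
    signPow q n a = (-1) ^ (∑ r, n r - ∑ r, a r) * q ^ (∑ r, n r - ∑ r, a r).choose 2 := by
  have h1 : total n - total a = ((∑ r, n r - ∑ r, a r : ℕ) : ℤ) := by
    rw [Nat.cast_sub (sum_le_sum fun r _ => ha r), total, total]
    push_cast
    rfl
  rw [signPow, h1]
  set d := ∑ r, n r - ∑ r, a r
  have h2 : (d : ℤ) * (d - 1) / 2 = ((d.choose 2 : ℕ) : ℤ) := by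
    have := two_mul_choose_two_add d
    zify at this
    refine Int.ediv_eq_of_eq_mul_left (by norm_num) ?_
    linarith
  rw [h2, zpow_natCast, zpow_natCast]

theorem prod_node_sub_ne_zero {q : K} {X : Fin l → K} (hinj : Function.Injective (node q X))
    (a : Fin l → ℕ) : ∏ r, ∏ s ∈ Ioi r, (X r * q ^ a r - X s * q ^ a s) ≠ 0 := by
  refine prod_ne_zero_iff.2 fun r _ => prod_ne_zero_iff.2 fun s hs => sub_ne_zero.2 fun h => ?_
  have := hinj (a₁ := ⟨r, a r⟩) (a₂ := ⟨s, a s⟩) h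
  exact (mem_Ioi.1 hs).ne (congrArg Sigma.fst this)

/-- In the product of weights, nodes above the chosen ones give `facA q X n a`, and nodes below give
`facA q X a 0` through `prod_vandermonde_mul`. The chosen nodes themselves give the squared
Vandermonde product up to sign; one power of it survives on the right. -/
theorem exists_prod_facA_eq {q : K} (hq : q ≠ 0) {X : Fin l → K} (hX : ∀ r, X r ≠ 0)
    (hinj : Function.Injective (node q X)) (n : Fin l → ℕ) :
    ∃ C : K, ∀ a ≤ n,
      (∏ r, ∏ s, (facA q X n a r s)⁻¹) * (∏ r, ∏ s, (facA q X a 0 r s)⁻¹) * signPow q n a =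
        C * ((∏ r, weight q X n ⟨r, a r⟩) *
          ∏ r, ∏ s ∈ Ioi r, (X r * q ^ a r - X s * q ^ a s)) := by
  refine ⟨(∏ r, ∏ s ∈ Ioi r, (X r - X s)) * (∏ r, X r) ^ (∑ r, n r) *
    ((-1) ^ (∑ r, n r) * q ^ (∑ r, n r).choose 2) * ∏ r : Fin l, ∏ s ∈ Ioi r, (-1),
    fun a ha => ?_⟩
  have hle : ∑ r, a r ≤ ∑ r, n r := sum_le_sum fun r _ => ha r
  have hV := prod_node_sub_ne_zero hinj a
  have hV0 := prod_node_sub_ne_zero hinj 0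
  have hE := prod_vandermonde_mul q X a
  have hF1 : (∏ r, ∏ s, facA q X n a r s) * ∏ s, (X s * q ^ a s) ^ (∑ r, n r - ∑ r, a r) =
      ∏ r, ∏ s, ∏ m ∈ range (n r - a r), (X s * q ^ a s - X r * q ^ (a r + 1 + m)) := by
    rw [← sum_tsub_distrib _ fun r _ => ha r]
    simp_rw [← prod_pow_eq_pow_sum, ← facA_mul_pow hq hX ha, prod_mul_distrib]
    rw [prod_comm (s := (univ : Finset (Fin l))) (t := univ)
      (f := fun s r => (X s * q ^ a s) ^ (n r - a r))]
  have hF2 : (∏ r, ∏ s, facA q X a 0 r s) * ∏ s, X s ^ (∑ r, a r) =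
      ∏ r, ∏ s, ∏ m ∈ range (a r), (X s - X r * q ^ (m + 1)) := by
    have h : ∀ r s, ∏ m ∈ range (a r), (X s - X r * q ^ (m + 1)) =
        facA q X a 0 r s * X s ^ a r := by
      intro r s
      have := facA_mul_pow hq hX (a := 0) (n := a) (fun _ => Nat.zero_le _) r s
      simp only [Pi.zero_apply, pow_zero, mul_one, Nat.sub_zero, zero_add] at this
      rw [this]
      exact prod_congr rfl fun m _ => by rw [add_comm]
    simp_rw [h, prod_mul_distrib, ← prod_pow_eq_pow_sum]
    rw [prod_comm (s := (univ : Finset (Fin l))) (t := univ) (f := fun s r => X s ^ a r)]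
  have hw : ∏ r, weight q X n ⟨r, a r⟩ =
      ((∏ r, ∏ s, ∏ m ∈ range (a r), (X s * q ^ a s - X r * q ^ m)) *
        (∏ r, ∏ s, ∏ m ∈ range (n r - a r), (X s * q ^ a s - X r * q ^ (a r + 1 + m))) *
        ((∏ r : Fin l, ∏ s ∈ Ioi r, (-1)) *
          (∏ r, ∏ s ∈ Ioi r, (X r * q ^ a r - X s * q ^ a s)) ^ 2))⁻¹ := by
    simp_rw [weight, prod_nodes_erase ha, prod_inv_distrib, prod_mul_distrib, node]
    congr 1
    congr 1
    · congr 1 <;> exact prod_comm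
    · rw [← prod_prod_Ioi_mul_eq_prod_prod_off_diag
        fun s r => X r * q ^ a r - X s * q ^ a s]
      simp_rw [← prod_pow, ← prod_mul_distrib]
      exact prod_congr rfl fun r _ => prod_congr rfl fun s _ => by ring
  have hPR : (∏ s, (X s * q ^ a s) ^ (∑ r, n r - ∑ r, a r)) * ∏ s, X s ^ (∑ r, a r) =
      (∏ r, X r) ^ (∑ r, n r) * q ^ ((∑ r, a r) * (∑ r, n r - ∑ r, a r)) := by
    rw [prod_pow, prod_pow, prod_mul_distrib, prod_pow_eq_pow_sum, mul_pow, ← pow_mul]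
    conv_rhs => rw [← Nat.sub_add_cancel hle, pow_add]
    rw [Nat.sub_add_cancel hle]
    ring
  have hP : ∏ s, (X s * q ^ a s) ^ (∑ r, n r - ∑ r, a r) ≠ 0 :=
    prod_ne_zero_iff.2 fun s _ => pow_ne_zero _ (mul_ne_zero (hX s) (pow_ne_zero _ hq))
  have hR : ∏ s, X s ^ (∑ r, a r) ≠ 0 :=
    prod_ne_zero_iff.2 fun s _ => pow_ne_zero _ (hX s)
  simp only [Pi.zero_apply, pow_zero, mul_one] at hV0
  rw [signPow_eq q ha]
  simp_rw [prod_inv_distrib]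
  rw [hw]
  generalize (∏ r, ∏ s, ∏ m ∈ range (n r - a r),
    (X s * q ^ a s - X r * q ^ (a r + 1 + m))) = A at *
  generalize (∏ r, ∏ s, ∏ m ∈ range (a r), (X s * q ^ a s - X r * q ^ m)) = B at *
  generalize (∏ r, ∏ s, ∏ m ∈ range (a r), (X s - X r * q ^ (m + 1))) = E at *
  generalize (∏ r, ∏ s ∈ Ioi r, (X r * q ^ a r - X s * q ^ a s)) = V at *
  generalize (∏ r, ∏ s ∈ Ioi r, (X r - X s)) = V₀ at *
  generalize (∏ r, ∏ s, facA q X n a r s) = F₁ at *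
  generalize (∏ r, ∏ s, facA q X a 0 r s) = F₂ at *
  generalize (∏ s, (X s * q ^ a s) ^ (∑ r, n r - ∑ r, a r)) = P at *
  generalize (∏ s, X s ^ (∑ r, a r)) = R at *
  generalize (∏ r, X r) = Z at *
  have hσ : (∏ r : Fin l, ∏ s ∈ Ioi r, (-1 : K)) ≠ 0 :=
    prod_ne_zero_iff.2 fun r _ => prod_ne_zero_iff.2 fun s _ => neg_ne_zero.2 one_ne_zero
  generalize (∏ r : Fin l, ∏ s ∈ Ioi r, (-1 : K)) = σ at *
  obtain ⟨d, hd⟩ := Nat.exists_eq_add_of_le hle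
  rw [hd] at hPR ⊢
  simp only [Nat.add_sub_cancel_left] at hPR ⊢
  -- The cross term `c * d` of the binomial exponent cancels the power of `q` left by clearing
  -- denominators in `hPR`.
  rw [choose_two_add]
  generalize ∑ r, a r = c at *
  have e1 : F₁ = A * P⁻¹ := by rw [← hF1, mul_inv_cancel_right₀ hP]
  have e2 : B = V₀ * (F₂ * R) * ((-1) ^ c * q ^ c.choose 2) * V⁻¹ := by
    rw [hF2, hE, mul_comm V, mul_inv_cancel_right₀ hV]
  have e3 : Z ^ (c + d) = P * R * (q ^ (c * d))⁻¹ := by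
    rw [hPR, mul_inv_cancel_right₀ (pow_ne_zero _ hq)]
  rw [e1, e2, e3]
  have hs : ((-1 : K) ^ c) ≠ 0 := pow_ne_zero _ (neg_ne_zero.2 one_ne_zero)
  simp only [mul_inv, inv_inv, pow_add]
  generalize ((-1 : K) ^ c) = sc at *
  generalize ((-1 : K) ^ d) = sd at *
  have hq1 := pow_ne_zero (c * d) hq
  have hq2 := pow_ne_zero (c.choose 2) hq
  generalize q ^ (c * d) = q1 at *
  generalize q ^ (c.choose 2) = q2 at *
  generalize q ^ (d.choose 2) = q3 at *
  generalize A⁻¹ = A' at *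
  generalize F₂⁻¹ = F' at *
  field_simp

end Weights

/-! ### Vanishing of the weighted Vandermonde sums -/

section Sums

variable {K : Type*} [Field K] {l : ℕ}

open Finset Polynomial

theorem sum_Icc_prod_mul_prod_antisymm_eq_zero [CharZero K]
    {φ : (_ : Fin l) × ℕ → (_ : Fin l) × ℕ → K} (hφ : ∀ s t, φ s t = -φ t s)
    (w : (_ : Fin l) × ℕ → K) (n : Fin l → ℕ) (r₀ : Fin l)
    (h : ∀ a ≤ n, ∑ r, ∑ m ∈ range (n r + 1),
      w ⟨r, m⟩ * ∏ s ∈ {r₀}ᶜ, φ ⟨r, m⟩ ⟨s, a s⟩ = 0) :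
    ∑ a ∈ Icc 0 n, (∏ r, w ⟨r, a r⟩) * ∏ r, ∏ s ∈ Ioi r, φ ⟨r, a r⟩ ⟨s, a s⟩ = 0 := by
  classical
  set A : Fin l → Finset ((_ : Fin l) × ℕ) := fun r =>
    (range (n r + 1)).map (Function.Embedding.sigmaMk (β := fun _ : Fin l => ℕ) r) with hA
  have memA : ∀ r p, p ∈ A r ↔ p.1 = r ∧ p.2 ≤ n r := by
    rintro r ⟨s, m⟩
    simp only [hA, mem_map, mem_range, Function.Embedding.sigmaMk_apply, Nat.lt_succ_iff]
    constructor
    · rintro ⟨k, hk, he⟩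
      cases he
      exact ⟨rfl, hk⟩
    · rintro ⟨rfl, hm⟩
      exact ⟨m, hm, rfl⟩
  rw [← sum_piFinset_prod_mul_prod_antisymm_eq_zero hφ w A r₀ ?_]
  · refine sum_nbij' (fun a r => ⟨r, a r⟩) (fun p r => (p r).2) ?_ ?_ ?_ ?_ ?_
    · intro a ha
      rw [Fintype.mem_piFinset]
      exact fun r => (memA _ _).2 ⟨rfl, (mem_Icc.1 ha).2 r⟩
    · intro p hp
      rw [Fintype.mem_piFinset] at hp
      exact mem_Icc.2 ⟨fun r => Nat.zero_le _, fun r => ((memA _ _).1 (hp r)).2⟩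
    · intro a _
      rfl
    · intro p hp
      rw [Fintype.mem_piFinset] at hp
      funext r
      obtain ⟨h1, -⟩ := (memA _ _).1 (hp r)
      exact Sigma.ext h1.symm HEq.rfl
    · intro a _
      rfl
  · intro p hp
    -- Slot `r₀` of `p` is unconstrained and never used; `0` is a filler within bounds.
    have h1 := h (fun s => if s = r₀ then 0 else (p s).2) (fun s => by
      dsimp only
      split_ifs with hs
      · exact Nat.zero_le _
      · exact ((memA _ _).1 (hp s hs)).2)
    rw [← h1]
    refine sum_congr rfl fun r _ => ?_
    rw [hA, sum_map]
    refine sum_congr rfl fun m _ => ?_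
    rw [Function.Embedding.sigmaMk_apply]
    congr 1
    refine prod_congr rfl fun s hs => ?_
    rw [mem_compl, mem_singleton] at hs
    rw [if_neg hs]
    congr 1
    obtain ⟨h2, -⟩ := (memA _ _).1 (hp s hs)
    generalize p s = z at h2 ⊢
    obtain ⟨t, k⟩ := z
    cases h2
    rfl

theorem natDegree_prod_X_sub_C_compl (r₀ : Fin l) (u : Fin l → K) :
    (∏ s ∈ {r₀}ᶜ, (X - C (u s))).natDegree + 1 = l := by
  rw [natDegree_finsetProd_X_sub_C_eq_card, card_compl, card_singleton, Fintype.card_fin]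
  have := r₀.pos
  omega

theorem natDegree_one_sub_C_mul_X_le (c : K) : (1 - C c * X : K[X]).natDegree ≤ 1 := by
  compute_degree

theorem natDegree_prod_range_one_sub_le (d : ℕ) (c : ℕ → K) :
    (∏ t ∈ range d, (1 - C (c t) * X)).natDegree ≤ d := by
  refine (natDegree_prod_le _ _).trans ?_
  refine (sum_le_sum fun t _ => natDegree_one_sub_C_mul_X_le _).trans ?_
  simp

theorem sum_weight_eval_vandermonde_eq_zero [CharZero K] {q : K} {x : Fin l → K}
    (hinj : Function.Injective (node q x)) {n : Fin l → ℕ} (hn : n ≠ 0) (P : K[X])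
    (hP : P.natDegree + 1 ≤ ∑ r, n r) :
    ∑ a ∈ Icc 0 n, (∏ r, weight q x n ⟨r, a r⟩ * P.eval (x r * q ^ a r)) *
      ∏ r, ∏ s ∈ Ioi r, (x r * q ^ a r - x s * q ^ a s) = 0 := by
  obtain ⟨r₀, -⟩ := Function.ne_iff.1 hn
  refine sum_Icc_prod_mul_prod_antisymm_eq_zero (φ := fun p p' => node q x p - node q x p')
    (fun s t => (neg_sub _ _).symm) (fun p => weight q x n p * P.eval (node q x p)) n r₀
    fun a _ => ?_
  rw [← sum_weight_mul_eval q x n hinj (P * ∏ s ∈ {r₀}ᶜ, (X - C (node q x ⟨s, a s⟩)))]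
  · simp [eval_prod, mul_assoc]
  · have h1 := natDegree_prod_X_sub_C_compl r₀ fun s => node q x ⟨s, a s⟩
    have h2 := natDegree_mul_le (p := P) (q := ∏ s ∈ {r₀}ᶜ, (X - C (node q x ⟨s, a s⟩)))
    omega

/-- The `s`-th factor of the rational function which, at the points `X_r q ^ m`, is proportional
to the part of the weights that involves the products `x_r x_s`. -/
def ratFactor (q : K) (x : Fin l → K) (n : Fin l → ℕ) (s : Fin l) (u : K) : K :=
  if n s = 0 then (1 - x s * u)⁻¹ else ∏ k ∈ range (n s - 1), (1 - x s * q ^ (k + 1) * u)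

/-- Against the factors `1 - u p_s`, `s ≠ r₀`, the poles of `ratFactor` cancel: a pole occurs only
for `n s = 0`, where `p_s = x_s` is forced. Rows with `n r = 0` get the factor `1`, since `1 - x_r ^
2` may vanish. -/
theorem sum_weight_ratFactor_symplectic_eq_zero [CharZero K] {q : K} {x : Fin l → K}
    (hinj : Function.Injective (node q x))
    (hx : ∀ r s, r ≠ s → ∀ k : ℕ, x r * x s * q ^ k ≠ 1) {n : Fin l → ℕ} (hn : n ≠ 0) :
    ∑ a ∈ Icc 0 n, (∏ r, weight q x n ⟨r, a r⟩ *
        if n r = 0 then 1 else ∏ s, ratFactor q x n s (x r * q ^ a r)) *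
      ∏ r, ∏ s ∈ Ioi r, (x r * q ^ a r - x s * q ^ a s) *
        (1 - x r * q ^ a r * (x s * q ^ a s)) = 0 := by
  obtain ⟨r₀, hr₀⟩ := Function.ne_iff.1 hn
  rw [Pi.zero_apply] at hr₀
  refine sum_Icc_prod_mul_prod_antisymm_eq_zero
    (φ := fun p p' => (node q x p - node q x p') * (1 - node q x p * node q x p'))
    (fun s t => by ring) (fun p => weight q x n p *
      if n p.1 = 0 then 1 else ∏ s, ratFactor q x n s (node q x p)) n r₀ fun a ha => ?_
  -- The polynomial left after cancelling. As `n r₀ ≠ 0`, the factor missing at `r₀` lowers the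
  -- total degree to at most `|n| - 1`.
  let f : Fin l → K[X] := fun s => if n s = 0 then 1 else
    (if s = r₀ then 1 else 1 - C (node q x ⟨s, a s⟩) * X) *
      ∏ k ∈ range (n s - 1), (1 - C (x s * q ^ (k + 1)) * X)
  have hf : ∀ s, (f s).natDegree + (if s = r₀ then 1 else 0) ≤ n s := by
    intro s
    have h1 := natDegree_prod_range_one_sub_le (n s - 1) fun k => x s * q ^ (k + 1)
    have h2 := natDegree_one_sub_C_mul_X_le (node q x ⟨s, a s⟩)
    by_cases h0 : n s = 0
    · have : s ≠ r₀ := by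
        rintro rfl
        exact hr₀ h0
      simp [f, h0, this]
    · simp only [f, if_neg h0]
      by_cases hs : s = r₀
      · simp only [if_pos hs, one_mul]
        omega
      · simp only [if_neg hs]
        refine (Nat.add_le_add_right natDegree_mul_le 0).trans ?_
        omega
  rw [← sum_weight_mul_eval q x n hinj ((∏ s ∈ {r₀}ᶜ, (X - C (node q x ⟨s, a s⟩))) * ∏ s, f s)]
  · refine sum_congr rfl fun r _ => sum_congr rfl fun m hm => ?_
    rw [mul_assoc]
    congr 1
    rw [eval_mul, eval_prod, eval_prod]
    simp only [eval_sub, eval_X, eval_C, prod_mul_distrib]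
    by_cases hr : n r = 0
    · have h0 : ∏ s ∈ {r₀}ᶜ, (node q x ⟨r, m⟩ - node q x ⟨s, a s⟩) = 0 := by
        refine prod_eq_zero (i := r) ?_ ?_
        · rw [mem_compl, mem_singleton]
          rintro rfl
          exact hr₀ hr
        · have h1 : a r = 0 := Nat.le_zero.1 (hr ▸ ha r)
          have h2 : m = 0 := by
            rw [mem_range] at hm
            omega
          rw [h1, h2, sub_self]
      rw [h0]
      ring
    · rw [if_neg hr]
      have h1 : ∏ s ∈ {r₀}ᶜ, (1 - node q x ⟨r, m⟩ * node q x ⟨s, a s⟩) =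
          ∏ s, if s = r₀ then 1 else (1 - node q x ⟨r, m⟩ * node q x ⟨s, a s⟩) := by
        rw [Fintype.prod_eq_mul_prod_compl r₀, if_pos rfl, one_mul]
        refine prod_congr rfl fun s hs => ?_
        rw [mem_compl, mem_singleton] at hs
        rw [if_neg hs]
      rw [mul_left_comm]
      congr 1
      rw [h1, ← prod_mul_distrib]
      refine prod_congr rfl fun s _ => ?_
      by_cases h0 : n s = 0
      · have hs : s ≠ r₀ := by
          rintro rfl
          exact hr₀ h0
        have h2 : a s = 0 := Nat.le_zero.1 (h0 ▸ ha s)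
        have hrs : r ≠ s := by
          rintro rfl
          exact hr h0
        simp only [ratFactor, f, if_pos h0, if_neg hs, eval_one, h2, node, pow_zero, mul_one]
        rw [mul_comm (x r * q ^ m)]
        refine inv_mul_cancel₀ (sub_ne_zero.2 fun h => hx r s hrs m ?_)
        rw [h]
        ring
      · simp only [ratFactor, f, if_neg h0, eval_mul, eval_prod, eval_sub, eval_one, eval_C,
          eval_X]
        rw [mul_comm]
        congr 1
        split_ifs
        · simp
        · rw [eval_sub, eval_mul, eval_one, eval_C, eval_X, mul_comm]
  · have h1 := natDegree_prod_X_sub_C_compl r₀ fun s => node q x ⟨s, a s⟩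
    have h2 := natDegree_mul_le (p := ∏ s ∈ {r₀}ᶜ, (X - C (node q x ⟨s, a s⟩))) (q := ∏ s, f s)
    have h3 := natDegree_prod_le univ f
    have h4 := sum_le_sum fun s (_ : s ∈ univ) => hf s
    rw [sum_add_distrib, sum_ite_eq' univ r₀, if_pos (mem_univ _)] at h4
    omega

end Sums

/-! ### Shift to `j = 0` and distinctness of the nodes -/

section Reduction

variable {K : Type*} [Field K] {l : ℕ}

open Finset

theorem qPoch_natCast (q b : K) (m : ℕ) : qPoch q b m = ∏ k ∈ range m, (1 - b * q ^ k) := by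
  simp [qPoch]

theorem qPoch_zero (q b : K) : qPoch q b 0 = 1 := by
  simp [qPoch]

theorem qPoch_self_neg {q : K} (hq : q ≠ 0) {n : ℤ} (hn : n < 0) : qPoch q q n = 0 := by
  rw [qPoch, prod_eq_zero (s := range (-n).toNat) (i := 0), div_zero]
  · rw [mem_range]
    omega
  · simp [hq]

theorem qPoch_sub_one_mul {q : K} (hq : q ≠ 0) {b : K} (hb : b ≠ q) (m : ℕ) :
    qPoch q b ((m : ℤ) - 1) * (1 - b * q ^ ((m : ℤ) - 1)) = qPoch q b m := by
  rcases m with _ | m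
  -- Here `(b)_{-1} = 1 / (1 - b / q)`, which is why `b ≠ q` is required.
  · have h : 1 - b * q⁻¹ ≠ 0 := by
      rw [sub_ne_zero, ← div_eq_mul_inv]
      exact fun h => hb ((div_eq_one_iff_eq hq).1 h.symm)
    simp [qPoch, h]
  · have h : ((m + 1 : ℕ) : ℤ) - 1 = m := by push_cast; ring
    rw [h, qPoch_natCast, qPoch_natCast, prod_range_succ, zpow_natCast]

theorem facA_shift {q : K} (hq : q ≠ 0) (x : Fin l → K) (j n a : Fin l → ℕ) (r s : Fin l) :
    facA q x (j + n) (j + a) r s = facA q (fun r => x r * q ^ j r) n a r s := by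
  simp only [facA, Pi.add_apply]
  congr 1
  · push_cast
    rw [add_sub_add_comm, zpow_add₀ hq, zpow_sub₀ hq, zpow_natCast, zpow_natCast]
    ring
  · push_cast
    ring

theorem facC_shift (q : K) (x : Fin l → K) (j n a : Fin l → ℕ) (r s : Fin l) :
    facC q x (j + n) (j + a) r s = facC q (fun r => x r * q ^ j r) n a r s := by
  simp only [facC, Pi.add_apply]
  congr 1
  · ring
  · push_cast
    ring

theorem facCstar_shift (q : K) (x : Fin l → K) (j n a : Fin l → ℕ) (r s : Fin l) :
    facCstar q x (j + n) (j + a) r s = facCstar q (fun r => x r * q ^ j r) n a r s := by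
  simp only [facCstar, Pi.add_apply]
  congr 1
  · ring
  · push_cast
    ring

theorem total_add (j a : Fin l → ℕ) : total (j + a) = total j + total a := by
  simp [total, sum_add_distrib]

theorem signPow_shift (q : K) (j n a : Fin l → ℕ) :
    signPow q (j + n) (j + a) = signPow q n a := by
  simp only [signPow, total_add, add_sub_add_left_eq_sub]

theorem signPow_self (q : K) (i : Fin l → ℕ) : signPow q i i = 1 := by
  simp [signPow]

theorem facA_self (q : K) (x : Fin l → K) (i : Fin l → ℕ) (r s : Fin l) :
    facA q x i i r s = 1 := by
  rw [facA, sub_self, qPoch_zero]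

theorem facA_diag_eq_zero {q : K} (hq : q ≠ 0) {x : Fin l → K} {i j : Fin l → ℕ} {k : Fin l}
    (hx : x k ≠ 0) (h : i k < j k) : facA q x i j k k = 0 := by
  rw [facA, sub_self, zpow_zero, mul_one, div_self hx, mul_one]
  exact qPoch_self_neg hq (by omega)

theorem sum_Icc_add {M : Type*} [AddCommMonoid M] (f : (Fin l → ℕ) → M) (j n : Fin l → ℕ) :
    ∑ y ∈ Icc j (j + n), f y = ∑ a ∈ Icc 0 n, f (j + a) := by
  have h := map_add_left_Icc (0 : Fin l → ℕ) n j
  rw [add_zero] at h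
  rw [← h, sum_map]
  rfl

theorem node_injective {q : K} (hq : q ≠ 0) (hq' : Function.Injective fun m : ℕ => q ^ m)
    {x : Fin l → K} (hx : ∀ r, x r ≠ 0)
    (hA : ∀ i j : Fin l → ℕ, j ≤ i → ∀ r s, facA q x i j r s ≠ 0) :
    Function.Injective (node q x) := by
  rintro ⟨r, m⟩ ⟨s, m'⟩ h
  simp only [node] at h
  by_cases hrs : r = s
  · subst hrs
    rw [hq' (mul_left_cancel₀ (hx r) h)]
  · exfalso
    -- Chosen so that `facA` is the single factor `1 - x_r q ^ m / (x_s q ^ m')`; the `+ 1` absorbs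
    -- the leading `q`.
    set j : Fin l → ℕ := fun t => if t = r then m else m' + 1 with hj
    refine hA (fun t => j t + 1) j (fun t => Nat.le_succ _) r s ?_
    have h1 : ((j r + 1 : ℕ) : ℤ) - j r = (1 : ℕ) := by push_cast; ring
    rw [facA, h1, qPoch_natCast, prod_range_one, hj]
    simp only [if_neg (Ne.symm hrs), if_true, pow_zero, mul_one]
    rw [zpow_sub₀ hq, zpow_natCast, zpow_natCast, pow_succ]
    have := hx s
    field_simp
    rw [h]
    ring

theorem node_shift_injective {q : K} {x : Fin l → K} (h : Function.Injective (node q x))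
    (j : Fin l → ℕ) : Function.Injective (node q fun r => x r * q ^ j r) := by
  rintro ⟨r, m⟩ ⟨s, m'⟩ he
  have h1 : node q x ⟨r, j r + m⟩ = node q x ⟨s, j s + m'⟩ := by
    simp only [node, pow_add, ← mul_assoc] at he ⊢
    exact he
  have h2 := h h1
  simp only [Sigma.mk.injEq, heq_eq_eq] at h2
  obtain ⟨rfl, h3⟩ := h2
  rw [Nat.add_left_cancel h3]

end Reduction

/-! ### The case `A_ℓ` -/

section TypeA

variable {K : Type*} [Field K] {n : ℕ}

open Finset Polynomial

theorem MA_eq_zero {q : K} (hq : q ≠ 0) (a : K) {x : Fin (n + 1) → K} (hx : ∀ k, x k ≠ 0)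
    {i j : Fin (n + 1) → ℕ} (h : ¬ j ≤ i) : MA q a x i j = 0 := by
  obtain ⟨k, hk⟩ := not_forall.1 h
  rw [MA, prod_eq_zero (mem_univ k) (prod_eq_zero (mem_univ k)
    (by rw [facA_diag_eq_zero hq (hx k) (not_le.1 hk), inv_zero])), zero_mul]

theorem MAstar_eq_zero {q : K} (hq : q ≠ 0) (a : K) {x : Fin (n + 1) → K} (hx : ∀ k, x k ≠ 0)
    {i j : Fin (n + 1) → ℕ} (h : ¬ j ≤ i) : MAstar q a x i j = 0 := by
  obtain ⟨k, hk⟩ := not_forall.1 h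
  rw [MAstar, prod_eq_zero (f := fun r => ∏ s, (facA q x i j r s)⁻¹) (mem_univ k)
    (prod_eq_zero (mem_univ k)
      (by rw [facA_diag_eq_zero hq (hx k) (not_le.1 hk), inv_zero])), mul_zero, zero_mul]

theorem total_eq_cast {l : ℕ} (j : Fin l → ℕ) : total j = ((∑ k, j k : ℕ) : ℤ) := by
  simp [total]

theorem MAstar_mul_MA_self {q a : K} (hq : q ≠ 0) {x : Fin (n + 1) → K}
    (h : NondegenerateA q a x) (i : Fin (n + 1) → ℕ) :
    MAstar q a x i i * MA q a x i i = 1 := by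
  simp only [MAstar, MA, facA_self, inv_one, prod_const_one, signPow_self, mul_one, one_mul]
  rw [← prod_mul_distrib, ← prod_mul_distrib]
  refine prod_eq_one fun k _ => ?_
  have h1 := (h.2.1 i i le_rfl).2 k
  have hb : a * q * (x k / x (Fin.last n)) ≠ q := by
    intro hb
    refine h.2.2 k (sub_eq_zero.2 (mul_right_cancel₀ hq ?_))
    rw [one_mul]
    linear_combination -hb
  rw [total_eq_cast, ← Nat.cast_add] at h1 ⊢
  have h2 := qPoch_sub_one_mul hq hb (i k + ∑ k, i k)
  rw [← h2] at h1 ⊢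
  have h3 : 1 - a * (x k / x (Fin.last n)) * q ^ (((i k + ∑ k, i k : ℕ)) : ℤ) =
      1 - a * q * (x k / x (Fin.last n)) * q ^ ((((i k + ∑ k, i k : ℕ)) : ℤ) - 1) := by
    rw [zpow_sub_one₀ hq]
    field_simp
  rw [h3, mul_comm (1 - _)]
  exact mul_inv_cancel₀ h1

theorem qPoch_mul_inv_qPoch {q b : K} (m d : ℕ) (h : qPoch q b m ≠ 0) :
    qPoch q b ((m + d : ℕ) : ℤ) * (qPoch q b m)⁻¹ = ∏ t ∈ range d, (1 - b * q ^ (m + t)) := by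
  rw [qPoch_natCast] at h ⊢
  rw [qPoch_natCast, prod_range_add, mul_comm, inv_mul_cancel_left₀ h]

theorem sum_MAstar_mul_MA [CharZero K] {q a : K} (hq : q ≠ 0)
    (hq' : Function.Injective fun m : ℕ => q ^ m) {x : Fin (n + 1) → K}
    (h : NondegenerateA q a x) {i j : Fin (n + 1) → ℕ} (hji : j ≤ i) (hne : j ≠ i) :
    ∑ y ∈ Icc j i, MAstar q a x i y * MA q a x y j = 0 := by
  obtain ⟨ν, rfl⟩ := exists_add_of_le hji
  have hν : ν ≠ 0 := by
    rintro rfl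
    exact hne (add_zero j).symm
  have hinj := node_shift_injective
    (node_injective hq hq' h.1 fun i j hij => (h.2.1 i j hij).1) j
  have hX : ∀ r, x r * q ^ j r ≠ 0 := fun r => mul_ne_zero (h.1 r) (pow_ne_zero _ hq)
  obtain ⟨c, hc⟩ := exists_prod_facA_eq hq hX hinj ν
  have hN : 0 < ∑ r, ν r := by
    obtain ⟨r, hr⟩ := Function.ne_iff.1 hν
    exact lt_of_lt_of_le (Nat.pos_of_ne_zero hr)
      (single_le_sum (f := ν) (fun _ _ => Nat.zero_le _) (mem_univ r))
  obtain ⟨d, hd⟩ := Nat.exists_eq_add_of_le' hN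
  -- The quotient of the two shifted factorials in `a` has `|ν| - 1 = d` factors, each linear in the
  -- node.
  set P : K[X] := ∏ t ∈ range d,
    (1 - C (a * q * (q ^ (∑ r, j r) * q ^ t) / x (Fin.last n)) * X) with hP
  have hPdeg : P.natDegree + 1 ≤ ∑ r, ν r := by
    rw [hd]
    exact Nat.add_le_add_right (natDegree_prod_range_one_sub_le d _) 1
  have hsum := sum_weight_eval_vandermonde_eq_zero hinj hν P hPdeg
  rw [sum_Icc_add]
  set e := ∏ k, (1 - a * (x k / x (Fin.last n)) *
    q ^ (((j + ν) k : ℕ) + total (j + ν) : ℤ)) with he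
  have key : ∀ b ∈ Icc 0 ν, MAstar q a x (j + ν) (j + b) * MA q a x (j + b) j =
      e * c * ((∏ r, weight q (fun r => x r * q ^ j r) ν ⟨r, b r⟩ *
          P.eval (x r * q ^ j r * q ^ b r)) *
        ∏ r, ∏ s ∈ Ioi r, (x r * q ^ j r * q ^ b r - x s * q ^ j s * q ^ b s)) := by
    intro b hb
    have h1 := hc b (mem_Icc.1 hb).2
    have h2 : ∀ r s, facA q x (j + b) j r s = facA q (fun r => x r * q ^ j r) b 0 r s := by
      intro r s
      rw [← facA_shift hq, add_zero]
    have h3 : (∏ k, qPoch q (a * q * (x k / x (Fin.last n)))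
          (((j + b) k : ℕ) + total (j + ν) - 1 : ℤ)) *
        ∏ k, (qPoch q (a * q * (x k / x (Fin.last n))) (((j + b) k : ℕ) + total j : ℤ))⁻¹ =
        ∏ r, P.eval (x r * q ^ j r * q ^ b r) := by
      rw [← prod_mul_distrib]
      refine prod_congr rfl fun k _ => ?_
      have h4 := (h.2.1 (j + b) j (le_add_of_nonneg_right fun r => Nat.zero_le (b r))).2 k
      have h5 : (((j + b) k : ℕ) + total (j + ν) - 1 : ℤ) =
          (((j + b) k + ∑ r, j r + d : ℕ) : ℤ) := by
        rw [total_add, total_eq_cast, total_eq_cast, hd]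
        push_cast
        ring
      rw [h5]
      rw [total_eq_cast, ← Nat.cast_add] at h4 ⊢
      rw [qPoch_mul_inv_qPoch _ _ h4, hP, eval_prod]
      refine prod_congr rfl fun t _ => ?_
      simp only [Pi.add_apply, eval_sub, eval_mul, eval_one, eval_C, eval_X, pow_add]
      ring
    rw [MAstar, MA, ← he, signPow_shift]
    simp_rw [facA_shift hq, h2]
    rw [prod_mul_distrib, ← h3]
    linear_combination (e * (∏ k, qPoch q (a * q * (x k / x (Fin.last n)))
        (((j + b) k : ℕ) + total (j + ν) - 1 : ℤ)) *
      ∏ k, (qPoch q (a * q * (x k / x (Fin.last n))) (((j + b) k : ℕ) + total j : ℤ))⁻¹) * h1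
  rw [sum_congr rfl key, ← mul_sum, hsum, mul_zero]

end TypeA

/-! ### The case `C_ℓ` -/

section TypeC

variable {K : Type*} [Field K] {l : ℕ}

open Finset

theorem MC_eq_zero {q : K} (hq : q ≠ 0) {x : Fin l → K} (hx : ∀ k, x k ≠ 0)
    {i j : Fin l → ℕ} (h : ¬ j ≤ i) : MC q x i j = 0 := by
  obtain ⟨k, hk⟩ := not_forall.1 h
  rw [MC]
  exact prod_eq_zero (mem_univ k) (prod_eq_zero (mem_univ k)
    (by rw [facA_diag_eq_zero hq (hx k) (not_le.1 hk), inv_zero, zero_mul]))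

theorem MCstar_eq_zero {q : K} (hq : q ≠ 0) {x : Fin l → K} (hx : ∀ k, x k ≠ 0)
    {i j : Fin l → ℕ} (h : ¬ j ≤ i) : MCstar q x i j = 0 := by
  obtain ⟨k, hk⟩ := not_forall.1 h
  rw [MCstar, prod_eq_zero (mem_univ k) (prod_eq_zero (mem_univ k)
    (by rw [facA_diag_eq_zero hq (hx k) (not_le.1 hk), inv_zero, zero_mul])), zero_mul, zero_mul]

theorem MCstar_mul_MC_self {q : K} {x : Fin l → K} (h : NondegenerateC q x) (i : Fin l → ℕ) :
    MCstar q x i i * MC q x i i = 1 := by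
  have h1 : ∏ r, ∏ s ∈ Ioi r,
      ((1 - x r * x s * q ^ (i r + i s)) / (1 - x r * x s * q ^ (i r + i s))) = 1 :=
    prod_eq_one fun r _ => prod_eq_one fun s hs => div_self (h.2.2 i r s (mem_Ioi.1 hs))
  rw [MCstar, h1]
  simp [MC, facA_self, facC, facCstar, qPoch_zero, signPow_self]

/-- The exponents of `q` occurring are `1, …, m` and `m + n_s, …, n_r + n_s - 1`. Compared with `1,
…, n_r + n_s - 1`, the `n_s - 1` exponents between are missing, or, if `n_s = 0`, the exponent `m`
is one too many: this is `ratFactor`. -/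
theorem prod_facC_eq {q : K} {x : Fin l → K} (hx : ∀ r s, ∀ k : ℕ, x r * x s * q ^ (k + 1) ≠ 1)
    {n : Fin l → ℕ} {r : Fin l} (hr : n r ≠ 0) {m : ℕ} (hm : m ≤ n r) (s : Fin l) :
    (∏ k ∈ range (n r - m), (1 - x r * x s * q ^ (m + n s) * q ^ k))⁻¹ *
        (∏ k ∈ range m, (1 - q * x r * x s * q ^ k))⁻¹ =
      (∏ k ∈ range (n r + n s - 1), (1 - x r * x s * q ^ (k + 1)))⁻¹ *
        ratFactor q x n s (x r * q ^ m) := by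
  have hE : ∏ k ∈ range m, (1 - q * x r * x s * q ^ k) =
      ∏ k ∈ range m, (1 - x r * x s * q ^ (k + 1)) :=
    prod_congr rfl fun k _ => by ring
  rw [hE, ratFactor]
  split_ifs with hs
  · rw [hs, ← mul_inv, ← mul_inv]
    congr 1
    obtain ⟨d, hd⟩ := Nat.exists_eq_add_of_le hm
    rw [hd, add_zero, Nat.add_sub_cancel_left, add_zero]
    have h1 : ∏ k ∈ range d, (1 - x r * x s * q ^ m * q ^ k) =
        ∏ k ∈ range d, (1 - x r * x s * q ^ (m + k)) :=
      prod_congr rfl fun k _ => by ring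
    rw [h1]
    rcases m with _ | m
    · obtain ⟨e, he⟩ := Nat.exists_eq_succ_of_ne_zero (hd ▸ hr)
      rw [zero_add] at he
      subst he
      simp only [zero_add, Nat.succ_eq_add_one, Nat.add_sub_cancel, range_zero, prod_empty,
        mul_one, pow_zero]
      rw [prod_range_succ', pow_zero, mul_one]
      ring
    · rw [prod_range_succ (fun k => 1 - x r * x s * q ^ (k + 1)) m,
        show m + 1 + d - 1 = m + d by omega, prod_range_add]
      have h5 : ∏ k ∈ range d, (1 - x r * x s * q ^ (m + 1 + k)) =
          ∏ k ∈ range d, (1 - x r * x s * q ^ (m + k + 1)) :=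
        prod_congr rfl fun k _ => by ring
      rw [h5]
      ring
  · have hF : ∏ k ∈ range (n s - 1), (1 - x s * q ^ (k + 1) * (x r * q ^ m)) =
        ∏ k ∈ range (n s - 1), (1 - x r * x s * q ^ (m + k + 1)) :=
      prod_congr rfl fun k _ => by ring
    have hD : ∏ k ∈ range (n r - m), (1 - x r * x s * q ^ (m + n s) * q ^ k) =
        ∏ k ∈ range (n r - m), (1 - x r * x s * q ^ (m + (n s - 1 + k) + 1)) := by
      refine prod_congr rfl fun k _ => ?_
      rw [show m + (n s - 1 + k) + 1 = m + n s + k by omega]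
      ring
    have hF0 : ∏ k ∈ range (n s - 1), (1 - x r * x s * q ^ (m + k + 1)) ≠ 0 :=
      prod_ne_zero_iff.2 fun k _ => sub_ne_zero.2 (hx r s _).symm
    rw [hF, hD, show n r + n s - 1 = m + (n s - 1 + (n r - m)) by omega, prod_range_add,
      prod_range_add, mul_inv, mul_inv, mul_assoc, mul_right_comm _ _
      (∏ k ∈ range (n s - 1), (1 - x r * x s * q ^ (m + k + 1))), inv_mul_cancel₀ hF0, one_mul,
      mul_comm]

theorem exists_prod_facC_eq {q : K} {x : Fin l → K}
    (hx : ∀ r s, ∀ k : ℕ, x r * x s * q ^ (k + 1) ≠ 1) (n : Fin l → ℕ) :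
    ∃ c : K, ∀ a ≤ n,
      (∏ r, ∏ s, (facCstar q x n a r s)⁻¹) * (∏ r, ∏ s, (facC q x a 0 r s)⁻¹) =
        c * ∏ r, if n r = 0 then 1 else ∏ s, ratFactor q x n s (x r * q ^ a r) := by
  refine ⟨∏ r, if n r = 0 then 1 else
    ∏ s, (∏ k ∈ range (n r + n s - 1), (1 - x r * x s * q ^ (k + 1)))⁻¹, fun a ha => ?_⟩
  rw [← prod_mul_distrib, ← prod_mul_distrib]
  refine prod_congr rfl fun r _ => ?_
  have har : a r ≤ n r := ha r
  have h1 : ∀ s, facCstar q x n a r s =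
      ∏ k ∈ range (n r - a r), (1 - x r * x s * q ^ (a r + n s) * q ^ k) := fun s => by
    rw [facCstar, ← Nat.cast_sub har, qPoch_natCast]
  have h2 : ∀ s, facC q x a 0 r s = ∏ k ∈ range (a r), (1 - q * x r * x s * q ^ k) := fun s => by
    rw [facC, Pi.zero_apply, Pi.zero_apply, Nat.cast_zero, sub_zero, qPoch_natCast, add_zero,
      pow_zero, mul_one]
  simp_rw [h1, h2]
  rw [← prod_mul_distrib]
  split_ifs with hr
  · have h0 : a r = 0 := by omega
    simp [hr, h0]
  · rw [← prod_mul_distrib]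
    exact prod_congr rfl fun s _ => prod_facC_eq hx hr har s

theorem sum_MCstar_mul_MC [CharZero K] {q : K} (hq : q ≠ 0)
    (hq' : Function.Injective fun m : ℕ => q ^ m) {x : Fin l → K}
    (h : NondegenerateC q x) {i j : Fin l → ℕ} (hji : j ≤ i) (hne : j ≠ i) :
    ∑ y ∈ Icc j i, MCstar q x i y * MC q x y j = 0 := by
  obtain ⟨ν, rfl⟩ := exists_add_of_le hji
  have hν : ν ≠ 0 := by
    rintro rfl
    exact hne (add_zero j).symm
  have hinj := node_shift_injective
    (node_injective hq hq' h.1 fun i j hij r s => (h.2.1 i j hij r s).1) j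
  have hX : ∀ r, x r * q ^ j r ≠ 0 := fun r => mul_ne_zero (h.1 r) (pow_ne_zero _ hq)
  -- For `r = s` only positive exponents are excluded; exponent `0` is excluded only for `r ≠ s`, by
  -- `hlt`.
  have hsucc : ∀ r s, ∀ k : ℕ, x r * x s * q ^ (k + 1) ≠ 1 := by
    intro r s k hk
    have h1 := (h.2.1 (fun _ => k + 1) 0 (fun _ => Nat.zero_le _) r s).2.1
    rw [facC, Pi.zero_apply, Nat.cast_zero, sub_zero, qPoch_natCast] at h1
    refine prod_ne_zero_iff.1 h1 k (by simp) ?_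
    rw [← hk]
    simp only [Pi.zero_apply]
    ring
  have hlt : ∀ r s, r < s → ∀ k : ℕ, x r * x s * q ^ k ≠ 1 := by
    intro r s hrs k hk
    refine h.2.2 (fun t => if t = r then k else 0) r s hrs ?_
    simp only [if_true, if_neg hrs.ne', add_zero]
    rw [hk, sub_self]
  have hneq : ∀ r s, r ≠ s → ∀ k : ℕ, x r * q ^ j r * (x s * q ^ j s) * q ^ k ≠ 1 := by
    intro r s hrs k hk
    have hk' : x r * x s * q ^ (j r + j s + k) = 1 := by
      rw [← hk]
      ring
    rcases hrs.lt_or_gt with h' | h'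
    · exact hlt r s h' _ hk'
    · exact hlt s r h' (j r + j s + k) (by rw [← hk', mul_comm (x s)])
  obtain ⟨c, hc⟩ := exists_prod_facA_eq hq hX hinj ν
  obtain ⟨c', hc'⟩ := exists_prod_facC_eq (q := q) (x := fun r => x r * q ^ j r)
    (fun r s k hk => hsucc r s (j r + j s + k) (by rw [← hk]; ring)) ν
  have hsum := sum_weight_ratFactor_symplectic_eq_zero hinj hneq hν
  rw [sum_Icc_add]
  have key : ∀ b ∈ Icc 0 ν, MCstar q x (j + ν) (j + b) * MC q x (j + b) j =
      c * c' * (∏ r, ∏ s ∈ Ioi r, (1 - x r * x s * q ^ ((j + ν) r + (j + ν) s)))⁻¹ *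
      ((∏ r, weight q (fun r => x r * q ^ j r) ν ⟨r, b r⟩ *
        if ν r = 0 then 1 else
          ∏ s, ratFactor q (fun r => x r * q ^ j r) ν s (x r * q ^ j r * q ^ b r)) *
      ∏ r, ∏ s ∈ Ioi r, (x r * q ^ j r * q ^ b r - x s * q ^ j s * q ^ b s) *
        (1 - x r * q ^ j r * q ^ b r * (x s * q ^ j s * q ^ b s))) := by
    intro b hb
    have h1 := hc b (mem_Icc.1 hb).2
    have h1' := hc' b (mem_Icc.1 hb).2
    have h2 : ∀ r s, facA q x (j + b) j r s = facA q (fun r => x r * q ^ j r) b 0 r s := by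
      intro r s
      rw [← facA_shift hq, add_zero]
    have h3 : ∀ r s, facC q x (j + b) j r s = facC q (fun r => x r * q ^ j r) b 0 r s := by
      intro r s
      rw [← facC_shift, add_zero]
    have h4 : ∀ r s, 1 - x r * x s * q ^ ((j + b) r + (j + b) s) =
        1 - x r * q ^ j r * q ^ b r * (x s * q ^ j s * q ^ b s) := by
      intro r s
      simp only [Pi.add_apply]
      ring
    rw [MCstar, MC, signPow_shift]
    simp_rw [facA_shift hq, h2, facCstar_shift, h3, h4, prod_div_distrib, prod_mul_distrib,
      div_eq_mul_inv] at h1 h1' ⊢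
    generalize (∏ r, ∏ s ∈ Ioi r, (1 - x r * x s * q ^ ((j + ν) r + (j + ν) s)))⁻¹ = D
    generalize (∏ r, ∏ s ∈ Ioi r,
      (1 - x r * q ^ j r * q ^ b r * (x s * q ^ j s * q ^ b s))) = V at *
    generalize (∏ r, ∏ s, (facA q (fun r => x r * q ^ j r) ν b r s)⁻¹) = A₁ at *
    generalize (∏ r, ∏ s, (facA q (fun r => x r * q ^ j r) b 0 r s)⁻¹) = A₂ at *
    generalize (∏ r, ∏ s, (facCstar q (fun r => x r * q ^ j r) ν b r s)⁻¹) = B₁ at *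
    generalize (∏ r, ∏ s, (facC q (fun r => x r * q ^ j r) b 0 r s)⁻¹) = B₂ at *
    trans (A₁ * A₂ * signPow q ν b) * (B₁ * B₂) * D * V
    · ring
    · rw [h1, h1']
      ring
  rw [sum_congr rfl key, ← mul_sum, hsum, mul_zero]

end TypeC

end BaileyTransform

theorem mainTheorem1 (n : ℕ) (q : ℂ) (hq0 : q ≠ 0) (hq : ‖q‖ < 1)
    {K : Type*} [Field K] [Algebra ℂ K] (x : Fin (n + 1) → K) :
    (∀ a : K, BaileyTransform.NondegenerateA (algebraMap ℂ K q) a x →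
      BaileyTransform.AreInverseLowerTriangular
        (BaileyTransform.MA (algebraMap ℂ K q) a x)
        (BaileyTransform.MAstar (algebraMap ℂ K q) a x)) ∧
    (BaileyTransform.NondegenerateC (algebraMap ℂ K q) x →
      BaileyTransform.AreInverseLowerTriangular
        (BaileyTransform.MC (algebraMap ℂ K q) x)
        (BaileyTransform.MCstar (algebraMap ℂ K q) x)) := by
  have hcz : CharZero K := charZero_of_injective_algebraMap (algebraMap ℂ K).injective
  have hQ : algebraMap ℂ K q ≠ 0 := (map_ne_zero _).2 hq0
  have hpow : Function.Injective fun m : ℕ => algebraMap ℂ K q ^ m := by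
    intro m m' h
    simp only [← map_pow] at h
    -- Since `0 < ‖q‖ < 1`, the powers of `q` are distinguished by their norms.
    have h1 := congrArg norm ((algebraMap ℂ K).injective h)
    rw [norm_pow, norm_pow] at h1
    exact pow_right_injective₀ (norm_pos_iff.2 hq0) hq.ne h1
  refine ⟨fun a h => ?_, fun h => ?_⟩
  · exact BaileyTransform.areInverseLowerTriangular_of_mul_eq
      (fun i j hij => BaileyTransform.MA_eq_zero hQ a h.1 hij)
      (fun i j hij => BaileyTransform.MAstar_eq_zero hQ a h.1 hij)
      (BaileyTransform.MAstar_mul_MA_self hQ h)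
      (fun i j hij hne => BaileyTransform.sum_MAstar_mul_MA hQ hpow h hij hne)
  · exact BaileyTransform.areInverseLowerTriangular_of_mul_eq
      (fun i j hij => BaileyTransform.MC_eq_zero hQ h.1 hij)
      (fun i j hij => BaileyTransform.MCstar_eq_zero hQ h.1 hij)
      (BaileyTransform.MCstar_mul_MC_self h)
      (fun i j hij hne => BaileyTransform.sum_MCstar_mul_MC hQ hpow h hij hne)
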